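/- Let $d\lambda(z)=\frac1\pi e^{-|z|^2}\,dA(z)$ be the Gaussian measure on ${\mathbb C}$, where $dA$ is area measure, and let $F^2$ be the Fock space of all entire functions $f$ with $\|f\|^2=\int_{\mathbb C}|f(z)|^2\,d\lambda(z)<\infty$, with the inner product inherited from $L^2({\mathbb C},d\lambda)$. For $f\in L^2({\mathbb R})=L^2({\mathbb R},dx)$ let $$Bf(z)=c\int_{\mathbb R}f(x)e^{2xz-x^2-(z^2/2)}\,dx,\qquad z\in{\mathbb C},\quad c=(2/\pi)^{1/4}.$$ For real $a$ let $T_a$ be the unitary translation operator on $L^2({\mathbb R})$ given by $T_af(x)=f(x-a)$, and for complex $a$ let $W_a$ be the unitary Weyl operator on $F^2$ given by $W_af(z)=f(z-a)e^{z\overline a-\frac{|a|^2}2}$. Then the Bargmann transform $B$ is a unitary operator from $L^2({\mathbb R})$ onto $F^2$, and for every real $a$ $$BT_aB^{-1}=W_a$$ as operators on $F^2$; that is, $BT_aB^{-1}f(z)=f(z-a)e^{za-\frac{a^2}2}$ for all $f\in F^2$ and $z\in{\mathbb C}$. -/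

import Mathlib

open MeasureTheory Complex

namespace Bargmann

/-- The Gaussian measure `dλ(z) = π⁻¹ e^{-|z|²} dA(z)` on the complex plane. -/
noncomputable def gaussian : Measure ℂ :=
  (volume : Measure ℂ).withDensity fun z => ENNReal.ofReal (Real.pi⁻¹ * Real.exp (-‖z‖ ^ 2))

/-- The linear space of all entire functions that are square integrable for the Gaussian measure. -/
def fockSubmodule : Submodule ℂ (ℂ → ℂ) where
  carrier := {f | Differentiable ℂ f ∧ MemLp f 2 gaussian}
  add_mem' hf hg := ⟨hf.1.add hg.1, hf.2.add hg.2⟩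
  zero_mem' := ⟨differentiable_const 0, MemLp.zero⟩
  smul_mem' c _ hf := ⟨hf.1.const_smul c, hf.2.const_smul c⟩

/-- The Fock space `F²`. -/
def Fock : Type := ↥fockSubmodule

namespace Fock

noncomputable instance : AddCommGroup Fock := inferInstanceAs (AddCommGroup ↥fockSubmodule)

noncomputable instance : Module ℂ Fock := inferInstanceAs (Module ℂ ↥fockSubmodule)

instance : CoeFun Fock fun _ => ℂ → ℂ := ⟨fun f => f.1⟩

theorem ext {f g : Fock} (h : ∀ z, f z = g z) : f = g := Subtype.ext (funext h)

theorem differentiable (f : Fock) : Differentiable ℂ f := f.2.1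

theorem memLp (f : Fock) : MemLp f 2 gaussian := f.2.2

/-- The inclusion of the Fock space into `L²(ℂ, dλ)`. -/
noncomputable def toLp : Fock →ₗ[ℂ] Lp ℂ 2 gaussian where
  toFun f := f.memLp.toLp f
  map_add' _ _ := rfl
  map_smul' _ _ := rfl

theorem volume_absolutelyContinuous : (volume : Measure ℂ) ≪ gaussian := by
  refine withDensity_absolutelyContinuous' (by fun_prop) (Filter.Eventually.of_forall fun z => ?_)
  have : 0 < Real.pi⁻¹ * Real.exp (-‖z‖ ^ 2) := by positivity
  simpa using this

theorem toLp_injective : Function.Injective toLp := by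
  intro f g h
  have h1 : (f : ℂ → ℂ) =ᵐ[gaussian] g := (MemLp.toLp_eq_toLp_iff f.memLp g.memLp).1 h
  have h2 : (f : ℂ → ℂ) =ᵐ[volume] g := volume_absolutelyContinuous.ae_eq h1
  have h3 := (Continuous.ae_eq_iff_eq volume f.differentiable.continuous
    g.differentiable.continuous).1 h2
  exact ext fun z => congrFun h3 z

/-- The norm and the inner product of the Fock space are inherited from `L²(ℂ, dλ)`. -/
noncomputable instance : NormedAddCommGroup Fock :=
  NormedAddCommGroup.induced Fock (Lp ℂ 2 gaussian) toLp toLp_injective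

noncomputable instance : InnerProductSpace ℂ Fock := InnerProductSpace.induced toLp

theorem norm_def (f : Fock) : ‖f‖ = (eLpNorm f 2 gaussian).toReal :=
  Lp.norm_toLp f f.memLp

end Fock

/-- The translation operator `T_a f(x) = f(x - a)`, as a unitary operator on `L²(ℝ)`. -/
noncomputable def translation (a : ℝ) :
    Lp ℂ 2 (volume : Measure ℝ) ≃ₗᵢ[ℂ] Lp ℂ 2 (volume : Measure ℝ) where
  toFun f := Lp.compMeasurePreservingₗᵢ ℂ (fun x : ℝ => x - a)
    (measurePreserving_sub_right volume a) f
  invFun f := Lp.compMeasurePreservingₗᵢ ℂ (fun x : ℝ => x + a)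
    (measurePreserving_add_right volume a) f
  map_add' := map_add _
  map_smul' := map_smul _
  norm_map' := LinearIsometry.norm_map _
  left_inv f := by
    refine Lp.ext ?_
    have h1 := Lp.coeFn_compMeasurePreserving
      (Lp.compMeasurePreserving (fun x : ℝ => x - a) (measurePreserving_sub_right volume a) f)
      (measurePreserving_add_right volume a)
    have h2 := (measurePreserving_add_right volume a).quasiMeasurePreserving.ae_eq_comp
      (Lp.coeFn_compMeasurePreserving f (measurePreserving_sub_right volume a))
    refine (h1.trans h2).trans (Filter.Eventually.of_forall fun x => ?_)
    simp
  right_inv f := by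
    refine Lp.ext ?_
    have h1 := Lp.coeFn_compMeasurePreserving
      (Lp.compMeasurePreserving (fun x : ℝ => x + a) (measurePreserving_add_right volume a) f)
      (measurePreserving_sub_right volume a)
    have h2 := (measurePreserving_sub_right volume a).quasiMeasurePreserving.ae_eq_comp
      (Lp.coeFn_compMeasurePreserving f (measurePreserving_add_right volume a))
    refine (h1.trans h2).trans (Filter.Eventually.of_forall fun x => ?_)
    simp

/-- The function `z ↦ f(z - a) k_a(z)`, where `k_a(z) = e^{z ā - |a|²/2}` is the normalized
reproducing kernel of the Fock space at `a`. -/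
noncomputable def weylFun (a : ℂ) (f : ℂ → ℂ) (z : ℂ) : ℂ :=
  f (z - a) * exp (z * (starRingEnd ℂ) a - (‖a‖ : ℂ) ^ 2 / 2)

theorem differentiable_weylFun (a : ℂ) {f : ℂ → ℂ} (hf : Differentiable ℂ f) :
    Differentiable ℂ (weylFun a f) := by
  unfold weylFun
  fun_prop

theorem weyl_density (a z : ℂ) :
    ‖exp (z * (starRingEnd ℂ) a - (‖a‖ : ℂ) ^ 2 / 2)‖ ^ 2 * Real.exp (-‖z‖ ^ 2) =
      Real.exp (-‖z - a‖ ^ 2) := by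
  rw [Complex.norm_exp, ← Real.exp_nat_mul, ← Real.exp_add]
  congr 1
  have h : (((‖a‖ : ℂ) ^ 2 / 2)).re = ‖a‖ ^ 2 / 2 := by
    rw [← Complex.ofReal_pow, ← Complex.ofReal_ofNat, ← Complex.ofReal_div, Complex.ofReal_re]
  rw [Complex.sub_re, h]
  simp only [← Complex.normSq_eq_norm_sq, Complex.normSq_apply, Complex.mul_re, Complex.conj_re,
    Complex.conj_im, Complex.sub_re, Complex.sub_im]
  push_cast
  ring

theorem lintegral_weylFun (a : ℂ) {f : ℂ → ℂ} (hf : Differentiable ℂ f) :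
    ∫⁻ z, ‖weylFun a f z‖ₑ ^ 2 ∂gaussian = ∫⁻ z, ‖f z‖ₑ ^ 2 ∂gaussian := by
  have hd : Measurable fun z : ℂ => ENNReal.ofReal (Real.pi⁻¹ * Real.exp (-‖z‖ ^ 2)) := by
    fun_prop
  have hw := (differentiable_weylFun a hf).continuous.measurable
  have hf' := hf.continuous.measurable
  rw [gaussian, lintegral_withDensity_eq_lintegral_mul _ hd (by fun_prop),
    lintegral_withDensity_eq_lintegral_mul _ hd (by fun_prop),
    ← lintegral_sub_right_eq_self
      ((fun z : ℂ => ENNReal.ofReal (Real.pi⁻¹ * Real.exp (-‖z‖ ^ 2))) * fun z => ‖f z‖ₑ ^ 2) a]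
  refine lintegral_congr fun z => ?_
  simp only [Pi.mul_apply, ← ofReal_norm]
  rw [← ENNReal.ofReal_pow (norm_nonneg _), ← ENNReal.ofReal_pow (norm_nonneg _),
    ← ENNReal.ofReal_mul (by positivity), ← ENNReal.ofReal_mul (by positivity),
    ← weyl_density a z, weylFun, norm_mul]
  congr 1
  ring

theorem eLpNorm_weylFun (a : ℂ) {f : ℂ → ℂ} (hf : Differentiable ℂ f) :
    eLpNorm (weylFun a f) 2 gaussian = eLpNorm f 2 gaussian := by
  have h := lintegral_weylFun a hf
  rw [eLpNorm_eq_lintegral_rpow_enorm_toReal (by norm_num) (by norm_num),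
    eLpNorm_eq_lintegral_rpow_enorm_toReal (by norm_num) (by norm_num)]
  simpa using congrArg (fun t => t ^ (2⁻¹ : ℝ)) h

theorem weylFun_mem (a : ℂ) (f : Fock) : weylFun a f ∈ fockSubmodule :=
  ⟨differentiable_weylFun a f.differentiable,
    (differentiable_weylFun a f.differentiable).continuous.aestronglyMeasurable, by
      rw [eLpNorm_weylFun a f.differentiable]
      exact f.memLp.2⟩

theorem weylFun_neg_weylFun (a : ℂ) (f : ℂ → ℂ) : weylFun (-a) (weylFun a f) = f := by
  funext z
  simp only [weylFun, sub_neg_eq_add, add_sub_cancel_right, norm_neg, map_neg]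
  rw [mul_assoc, ← Complex.exp_add]
  have h : (z + a) * (starRingEnd ℂ) a - (‖a‖ : ℂ) ^ 2 / 2 +
      (z * -(starRingEnd ℂ) a - (‖a‖ : ℂ) ^ 2 / 2) = 0 := by
    have := Complex.mul_conj' a
    linear_combination this
  rw [h, Complex.exp_zero, mul_one]

/-- The Weyl operator `W_a f(z) = f(z - a) e^{z ā - |a|²/2}`, as a unitary operator on the Fock
space. -/
noncomputable def weyl (a : ℂ) : Fock ≃ₗᵢ[ℂ] Fock where
  toFun f := ⟨weylFun a f, weylFun_mem a f⟩
  invFun f := ⟨weylFun (-a) f, weylFun_mem (-a) f⟩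
  map_add' f g := Fock.ext fun z => add_mul (f (z - a)) (g (z - a)) _
  map_smul' c f := Fock.ext fun z => mul_assoc c (f (z - a)) _
  left_inv f := Subtype.ext (weylFun_neg_weylFun a f)
  right_inv f := Subtype.ext (by simpa using weylFun_neg_weylFun (-a) f)
  norm_map' f := by
    rw [Fock.norm_def, Fock.norm_def]
    exact congrArg ENNReal.toReal (eLpNorm_weylFun a f.differentiable)

/-- The Bargmann integral `c ∫ f(x) e^{2xz - x² - z²/2} dx` with `c = (2/π)^{1/4}`. The integrand
is integrable for every `f` in `L²(ℝ)`, since the kernel is square integrable in `x`. -/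
noncomputable def bargmannIntegral (f : Lp ℂ 2 (volume : Measure ℝ)) (z : ℂ) : ℂ :=
  (((2 / Real.pi) ^ (1 / 4 : ℝ) : ℝ) : ℂ) *
    ∫ x : ℝ, f x * exp (2 * (x : ℂ) * z - (x : ℂ) ^ 2 - z ^ 2 / 2)

end Bargmann

namespace Bargmann

open scoped FourierTransform SchwartzMap ContDiff

/-! Isometry: for z = u + iv, completing the square shows that Bf(z) is, up to an explicit factor,
the Fourier transform at -v/π of f times a Gaussian centred at u (`bargmannIntegral_eq_fourier`).
The squared modulus of that factor is a constant times e^{|z|²}, which cancels the Gaussian weight.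
Plancherel in v and Tonelli in u then give ‖Bf‖ = ‖f‖.

Surjectivity: the range is complete, so it suffices that its orthogonal complement is zero. The
functions W_w 1 are images of explicit Gaussians (`weyl_fockOne_mem_range`), and by the mean value
property F ⟂ W_w 1 forces F(w) = 0 (`apply_eq_zero_of_inner_weyl_fockOne`).

Intertwining: substitute x ↦ x + a in the Bargmann integral (`bargmannIntegral_translation`). -/

/-! ### Plancherel for the Fourier integral on L¹ ∩ L². -/

theorem continuous_fourier {g : ℝ → ℂ} (hg : Integrable g) : Continuous (𝓕 g) :=
  VectorFourier.fourierIntegral_continuous (L := innerₗ ℝ) Real.continuous_fourierChar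
    continuous_inner hg

/-- The Fourier integral of a function in `L¹ ∩ L²` represents its `L²` Fourier transform. -/
theorem fourier_ae_eq_fourier_toLp {g : ℝ → ℂ} (h1 : Integrable g) (h2 : MemLp g 2) :
    𝓕 g =ᵐ[volume] (𝓕 (h2.toLp g) : Lp ℂ 2 (volume : Measure ℝ)) := by
  refine ae_eq_of_integral_contDiff_smul_eq (continuous_fourier h1).locallyIntegrable
    ((Lp.memLp _).locallyIntegrable (by norm_num)) fun φ hφ hs => ?_
  have hs' : HasCompactSupport fun x => (φ x : ℂ) := hs.comp_left (g := fun t : ℝ => (t : ℂ)) rfl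
  have hφ' : ContDiff ℝ ∞ fun x => (φ x : ℂ) := Complex.ofRealCLM.contDiff.comp hφ
  let ψ : 𝓢(ℝ, ℂ) := hs'.toSchwartzMap hφ'
  have hψ (x : ℝ) : ψ x = (φ x : ℂ) := rfl
  -- The L² transform agrees with the distributional one, so testing against ψ moves the transform
  -- onto ψ; Fubini (`h4`) moves it back onto g as an integral.
  have key := congrArg (fun T => T ψ) (Lp.fourier_toTemperedDistribution_eq (h2.toLp g))
  simp only [TemperedDistribution.fourier_apply, Lp.toTemperedDistribution_apply] at key
  have h3 : ∫ x, (𝓕 ψ) x • (h2.toLp g) x = ∫ x, (𝓕 ψ) x • g x := by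
    refine integral_congr_ae ?_
    filter_upwards [h2.coeFn_toLp] with x hx
    rw [hx]
  have h4 : ∫ x, (𝓕 (ψ : ℝ → ℂ)) x • g x = ∫ x, ψ x • (𝓕 g) x := by
    have h := VectorFourier.integral_fourierIntegral_smul_eq_flip (μ := volume) (ν := volume)
      (L := innerₗ ℝ) Real.continuous_fourierChar continuous_inner ψ.integrable h1
    rw [flip_innerₗ] at h
    exact h
  rw [h3, SchwartzMap.fourier_coe, h4] at key
  simpa [hψ] using key

/-- Plancherel's theorem for the Fourier integral on `L¹ ∩ L²`. -/
theorem lintegral_enorm_fourier_sq {g : ℝ → ℂ} (h1 : Integrable g) (h2 : MemLp g 2) :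
    ∫⁻ w, ‖𝓕 g w‖ₑ ^ 2 = ∫⁻ x, ‖g x‖ₑ ^ 2 := by
  have h : eLpNorm (𝓕 g) 2 volume = eLpNorm g 2 volume := by
    rw [eLpNorm_congr_ae (fourier_ae_eq_fourier_toLp h1 h2), ← eLpNorm_congr_ae h2.coeFn_toLp,
      ← ENNReal.toReal_eq_toReal_iff' (Lp.eLpNorm_ne_top _) (Lp.eLpNorm_ne_top _),
      ← Lp.norm_def, ← Lp.norm_def, Lp.norm_fourier_eq]
  rw [eLpNorm_eq_lintegral_rpow_enorm_toReal (by norm_num) (by norm_num),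
    eLpNorm_eq_lintegral_rpow_enorm_toReal (by norm_num) (by norm_num)] at h
  have h' := ENNReal.rpow_left_injective (by norm_num) h
  simpa using h'

/-! ### Integrability of the Gaussian kernels. -/

theorem integrable_exp_mul_sub_sq (b : ℝ) :
    Integrable fun x : ℝ => Real.exp (2 * b * x - 2 * x ^ 2) := by
  have h := (integrable_cexp_quadratic (b := 2) (by simp) (2 * b) 0).norm
  refine h.congr (Filter.Eventually.of_forall fun x => ?_)
  simp only [Complex.norm_exp]
  congr 1
  have : -2 * (x : ℂ) ^ 2 + 2 * b * x + 0 = ((2 * b * x - 2 * x ^ 2 : ℝ) : ℂ) := by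
    push_cast
    ring
  rw [this, ofReal_re]

theorem memLp_real_exp_mul_sub_sq (b : ℝ) :
    MemLp (fun x : ℝ => Real.exp (b * x - x ^ 2)) 2 volume := by
  rw [memLp_two_iff_integrable_sq (by fun_prop)]
  refine (integrable_exp_mul_sub_sq b).congr (Filter.Eventually.of_forall fun x => ?_)
  simp only
  rw [← Real.exp_nat_mul]
  congr 1
  push_cast
  ring

theorem memLp_cexp_mul_sub_sq (s : ℂ) :
    MemLp (fun x : ℝ => exp (s * x - (x : ℂ) ^ 2)) 2 volume := by
  refine (memLp_real_exp_mul_sub_sq s.re).of_le (by fun_prop)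
    (Filter.Eventually.of_forall fun x => le_of_eq ?_)
  rw [Complex.norm_exp, Real.norm_of_nonneg (Real.exp_pos _).le, sub_re, re_mul_ofReal]
  norm_cast

theorem bargmannKernel_eq (x : ℝ) (z : ℂ) :
    exp (2 * (x : ℂ) * z - (x : ℂ) ^ 2 - z ^ 2 / 2) =
      exp (-(z ^ 2 / 2)) * exp (2 * z * x - (x : ℂ) ^ 2) := by
  rw [← Complex.exp_add]
  congr 1
  ring

theorem integrable_bargmann (f : Lp ℂ 2 (volume : Measure ℝ)) (z : ℂ) :
    Integrable fun x : ℝ => f x * exp (2 * (x : ℂ) * z - (x : ℂ) ^ 2 - z ^ 2 / 2) := by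
  simp only [bargmannKernel_eq]
  exact (Lp.memLp f).integrable_mul ((memLp_cexp_mul_sub_sq (2 * z)).const_mul _)

/-! ### Norm preservation through the windowed Fourier transform. -/

/-- The function `f` localized by a Gaussian centred at `u`. -/
noncomputable def gaussianWindow (f : ℝ → ℂ) (u x : ℝ) : ℂ := f x * (Real.exp (-(x - u) ^ 2) : ℂ)

theorem memLp_window (u : ℝ) : MemLp (fun x : ℝ => (Real.exp (-(x - u) ^ 2) : ℂ)) 2 volume := by
  refine ((memLp_cexp_mul_sub_sq (2 * u)).const_mul (exp (-u ^ 2))).ae_eq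
    (Filter.Eventually.of_forall fun x => ?_)
  simp only
  rw [← Complex.exp_add]
  push_cast
  congr 1
  ring

theorem integrable_gaussianWindow (f : Lp ℂ 2 (volume : Measure ℝ)) (u : ℝ) :
    Integrable (gaussianWindow f u) :=
  (Lp.memLp f).integrable_mul (memLp_window u)

theorem memLp_gaussianWindow (f : Lp ℂ 2 (volume : Measure ℝ)) (u : ℝ) :
    MemLp (gaussianWindow f u) 2 := by
  refine (Lp.memLp f).of_le (integrable_gaussianWindow f u).aestronglyMeasurable
    (Filter.Eventually.of_forall fun x => ?_)
  rw [gaussianWindow, norm_mul, norm_real, Real.norm_of_nonneg (Real.exp_pos _).le]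
  refine mul_le_of_le_one_right (norm_nonneg _) (Real.exp_le_one_iff.2 ?_)
  have := sq_nonneg (x - u)
  linarith

/-- The Bargmann integral is a short-time Fourier transform with Gaussian window. -/
theorem bargmannIntegral_eq_fourier (f : Lp ℂ 2 (volume : Measure ℝ)) (z : ℂ) :
    bargmannIntegral f z = (((2 / Real.pi) ^ (1 / 4 : ℝ) : ℝ) : ℂ) *
      (exp ((z.re : ℂ) ^ 2 - z ^ 2 / 2) * 𝓕 (gaussianWindow f z.re) (-Real.pi⁻¹ * z.im)) := by
  rw [bargmannIntegral, Real.fourier_real_eq_integral_exp_smul,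
    ← integral_const_mul (exp _)]
  congr 2
  funext x
  rw [gaussianWindow, smul_eq_mul, ofReal_exp]
  have h : ∀ a b c y : ℂ, a * (b * (y * c)) = y * (a * b * c) := fun a b c y => by ring
  rw [h, ← Complex.exp_add, ← Complex.exp_add]
  congr 2
  have hπ : (Real.pi : ℂ) ≠ 0 := by exact_mod_cast Real.pi_ne_zero
  have hz : 2 * (x : ℂ) * z = 2 * x * z.re + 2 * x * z.im * I := by
    conv_lhs => rw [← re_add_im z]
    ring
  rw [hz]
  push_cast
  field_simp
  ring

/-- With z = u + iv, Re(u² - z²/2) = |z|²/2, so the prefactor cancels the Gaussian weight exactly.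
-/
theorem enorm_bargmannIntegral_sq (f : Lp ℂ 2 (volume : Measure ℝ)) (z : ℂ) :
    ENNReal.ofReal (Real.pi⁻¹ * Real.exp (-‖z‖ ^ 2)) * ‖bargmannIntegral f z‖ₑ ^ 2 =
      ENNReal.ofReal (Real.sqrt (2 / Real.pi) * Real.pi⁻¹) *
        ‖𝓕 (gaussianWindow f z.re) (-Real.pi⁻¹ * z.im)‖ₑ ^ 2 := by
  have hπ := Real.pi_pos
  rw [bargmannIntegral_eq_fourier]
  simp only [← ofReal_norm, norm_mul]
  rw [← ENNReal.ofReal_pow (by positivity), ← ENNReal.ofReal_pow (by positivity),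
    ← ENNReal.ofReal_mul (by positivity), ← ENNReal.ofReal_mul (by positivity)]
  congr 1
  have h1 : ‖(((2 / Real.pi) ^ (1 / 4 : ℝ) : ℝ) : ℂ)‖ ^ 2 = Real.sqrt (2 / Real.pi) := by
    rw [norm_real, Real.norm_of_nonneg (by positivity), ← Real.rpow_natCast, ← Real.rpow_mul
      (by positivity), Real.sqrt_eq_rpow]
    norm_num
  have h2 : ‖exp ((z.re : ℂ) ^ 2 - z ^ 2 / 2)‖ ^ 2 * Real.exp (-‖z‖ ^ 2) = 1 := by
    rw [Complex.norm_exp, ← Real.exp_nat_mul, ← Real.exp_add, Real.exp_eq_one_iff,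
      ← Complex.normSq_eq_norm_sq, Complex.normSq_apply]
    have : ((z.re : ℂ) ^ 2 - z ^ 2 / 2).re = z.re ^ 2 - (z.re ^ 2 - z.im ^ 2) / 2 := by
      have h3 : (z ^ 2 / 2).re = (z.re ^ 2 - z.im ^ 2) / 2 := by
        rw [show z ^ 2 / 2 = z ^ 2 / ((2 : ℝ) : ℂ) by norm_num, div_ofReal_re, sq, mul_re]
        ring
      rw [sub_re, h3]
      norm_cast
    rw [this]
    push_cast
    ring
  rw [mul_pow, mul_pow, h1]
  linear_combination (Real.pi⁻¹ * Real.sqrt (2 / Real.pi) *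
    ‖𝓕 (gaussianWindow f z.re) (-Real.pi⁻¹ * z.im)‖ ^ 2) * h2

theorem lintegral_comp_mul_left {a : ℝ} (ha : a ≠ 0) {g : ℝ → ENNReal} (hg : Measurable g) :
    ∫⁻ v, g (a * v) = ENNReal.ofReal |a⁻¹| * ∫⁻ v, g v := by
  rw [← lintegral_map hg (measurable_const_mul a), Real.map_volume_mul_left ha,
    lintegral_smul_measure, smul_eq_mul]

theorem lintegral_window_sq (x : ℝ) :
    ∫⁻ u : ℝ, ENNReal.ofReal (Real.exp (-2 * (x - u) ^ 2)) =
      ENNReal.ofReal (Real.sqrt (Real.pi / 2)) := by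
  rw [lintegral_sub_left_eq_self (fun u : ℝ => ENNReal.ofReal (Real.exp (-2 * u ^ 2))) x,
    ← ofReal_integral_eq_lintegral_ofReal (integrable_exp_neg_mul_sq (by norm_num))
      (Filter.Eventually.of_forall fun _ => (Real.exp_pos _).le), integral_gaussian]

/-- By Tonelli, as the squared windows have the same integral over u for every x. -/
theorem lintegral_enorm_gaussianWindow_sq (f : Lp ℂ 2 (volume : Measure ℝ)) :
    ∫⁻ u : ℝ, ∫⁻ x, ‖gaussianWindow f u x‖ₑ ^ 2 =
      ENNReal.ofReal (Real.sqrt (Real.pi / 2)) * ∫⁻ x, ‖f x‖ₑ ^ 2 := by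
  have hf : Measurable (f : ℝ → ℂ) := (Lp.stronglyMeasurable f).measurable
  have h (u x : ℝ) : ‖gaussianWindow f u x‖ₑ ^ 2 =
      ‖f x‖ₑ ^ 2 * ENNReal.ofReal (Real.exp (-2 * (x - u) ^ 2)) := by
    rw [gaussianWindow, enorm_mul, mul_pow]
    congr 1
    rw [← ofReal_norm, norm_real, Real.norm_of_nonneg (Real.exp_pos _).le,
      ← ENNReal.ofReal_pow (Real.exp_pos _).le, ← Real.exp_nat_mul]
    congr 2
    push_cast
    ring
  simp only [h]
  rw [lintegral_lintegral_swap (by fun_prop), ← lintegral_const_mul _ (by fun_prop)]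
  refine lintegral_congr fun x => ?_
  rw [lintegral_const_mul _ (by fun_prop), lintegral_window_sq, mul_comm]

/-- The Bargmann integral preserves the square integral. -/
theorem lintegral_enorm_bargmannIntegral_sq (f : Lp ℂ 2 (volume : Measure ℝ))
    (hB : Continuous (bargmannIntegral f)) :
    ∫⁻ z, ‖bargmannIntegral f z‖ₑ ^ 2 ∂gaussian = ∫⁻ x, ‖f x‖ₑ ^ 2 := by
  have hπ := Real.pi_pos
  have hm : Measurable fun z : ℂ => ENNReal.ofReal (Real.pi⁻¹ * Real.exp (-‖z‖ ^ 2)) *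
      ‖bargmannIntegral f z‖ₑ ^ 2 := by
    have := hB.measurable
    fun_prop
  rw [gaussian, lintegral_withDensity_eq_lintegral_mul _ (by fun_prop)
    (hB.measurable.enorm.pow_const 2)]
  simp only [Pi.mul_apply]
  rw [← (volume_preserving_equiv_real_prod.symm).lintegral_comp hm, Measure.volume_eq_prod,
    lintegral_prod _ (by
      have := hm.comp (measurableEquivRealProd.symm.measurable)
      exact this.aemeasurable)]
  have h (u : ℝ) : ∫⁻ v : ℝ, ENNReal.ofReal (Real.pi⁻¹ *
        Real.exp (-‖measurableEquivRealProd.symm (u, v)‖ ^ 2)) *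
          ‖bargmannIntegral f (measurableEquivRealProd.symm (u, v))‖ₑ ^ 2 =
      ENNReal.ofReal (Real.sqrt (2 / Real.pi)) * ∫⁻ x, ‖gaussianWindow f u x‖ₑ ^ 2 := by
    have hF : Measurable (𝓕 (gaussianWindow f u)) :=
      (continuous_fourier (integrable_gaussianWindow f u)).measurable
    simp only [enorm_bargmannIntegral_sq, measurableEquivRealProd_symm_apply]
    -- Rescaling the frequency by -1/π yields a factor π, which cancels the π⁻¹ of the Gaussian
    -- density.
    rw [lintegral_const_mul _ (by fun_prop), lintegral_comp_mul_left
        (g := fun w => ‖𝓕 (gaussianWindow f u) w‖ₑ ^ 2)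
        (neg_ne_zero.2 (inv_ne_zero hπ.ne')) (by fun_prop),
      lintegral_enorm_fourier_sq (integrable_gaussianWindow f u) (memLp_gaussianWindow f u),
      ← mul_assoc, ← ENNReal.ofReal_mul (by positivity), inv_neg, inv_inv, abs_neg,
      abs_of_pos hπ, mul_assoc, inv_mul_cancel₀ hπ.ne', mul_one]
  simp only [h]
  rw [lintegral_const_mul' _ _ ENNReal.ofReal_ne_top, lintegral_enorm_gaussianWindow_sq,
    ← mul_assoc, ← ENNReal.ofReal_mul (by positivity), ← Real.sqrt_mul (by positivity)]
  have : 2 / Real.pi * (Real.pi / 2) = 1 := by field_simp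
  simp [this]

/-! ### Holomorphy of the Bargmann integral. -/

/-- A bound on the z-derivative of the kernel, uniform for |w| ≤ R and square integrable in x:
multiply |2x| ≤ e^{2x} + e^{-2x} by |e^{2wx}| ≤ e^{2Rx} + e^{-2Rx}. -/
theorem norm_two_mul_mul_cexp_le {R : ℝ} (x : ℝ) {w : ℂ} (hw : ‖w‖ ≤ R) :
    ‖2 * (x : ℂ) * exp (2 * w * x - (x : ℂ) ^ 2)‖ ≤
      Real.exp ((2 + 2 * R) * x - x ^ 2) + Real.exp ((2 - 2 * R) * x - x ^ 2) +
        Real.exp ((-2 + 2 * R) * x - x ^ 2) + Real.exp ((-2 - 2 * R) * x - x ^ 2) := by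
  have h1 : ‖2 * (x : ℂ)‖ ≤ Real.exp (2 * x) + Real.exp (-2 * x) := by
    rw [norm_mul, norm_real, Real.norm_eq_abs, Complex.norm_ofNat]
    rcases abs_cases x with h | h <;> rw [h.1]
    · have := Real.add_one_le_exp (2 * x)
      have := Real.exp_pos (-2 * x)
      linarith
    · have := Real.add_one_le_exp (-2 * x)
      have := Real.exp_pos (2 * x)
      linarith
  have h2 : ‖exp (2 * w * x - (x : ℂ) ^ 2)‖ ≤
      (Real.exp (2 * R * x) + Real.exp (-2 * R * x)) * Real.exp (-x ^ 2) := by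
    have h3 : (2 * w * x - (x : ℂ) ^ 2).re = 2 * w.re * x + -x ^ 2 := by
      rw [sub_re, re_mul_ofReal, ← ofReal_ofNat, re_ofReal_mul]
      norm_cast
    rw [Complex.norm_exp, h3, Real.exp_add]
    gcongr
    have h4 := abs_le.1 ((abs_re_le_norm w).trans hw)
    rcases le_total 0 x with hx | hx
    · have : Real.exp (2 * w.re * x) ≤ Real.exp (2 * R * x) := by
        gcongr
        exact h4.2
      linarith [Real.exp_pos (-2 * R * x)]
    · have : Real.exp (2 * w.re * x) ≤ Real.exp (-2 * R * x) :=
        Real.exp_le_exp.2 (mul_le_mul_of_nonpos_right (by linarith) hx)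
      linarith [Real.exp_pos (2 * R * x)]
  rw [norm_mul]
  refine (mul_le_mul h1 h2 (norm_nonneg _) (by positivity)).trans_eq ?_
  have e (a b : ℝ) : Real.exp ((a + b) * x - x ^ 2) =
      Real.exp (a * x) * Real.exp (b * x) * Real.exp (-x ^ 2) := by
    rw [← Real.exp_add, ← Real.exp_add]
    congr 1
    ring
  rw [sub_eq_add_neg 2 (2 * R), sub_eq_add_neg (-2) (2 * R), ← neg_mul 2 R, e, e, e, e]
  ring

theorem differentiable_integral_mul_cexp (f : Lp ℂ 2 (volume : Measure ℝ)) :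
    Differentiable ℂ fun z : ℂ => ∫ x : ℝ, f x * exp (2 * z * x - (x : ℂ) ^ 2) := by
  intro z
  let R := ‖z‖ + 1
  have hf := (Lp.memLp f).aestronglyMeasurable
  have hbound : MemLp (fun x : ℝ =>
      Real.exp ((2 + 2 * R) * x - x ^ 2) + Real.exp ((2 - 2 * R) * x - x ^ 2) +
        Real.exp ((-2 + 2 * R) * x - x ^ 2) + Real.exp ((-2 - 2 * R) * x - x ^ 2)) 2 volume :=
    (((memLp_real_exp_mul_sub_sq _).add (memLp_real_exp_mul_sub_sq _)).add
      (memLp_real_exp_mul_sub_sq _)).add (memLp_real_exp_mul_sub_sq _)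
  refine (hasDerivAt_integral_of_dominated_loc_of_deriv_le
    (F' := fun w x => f x * (2 * (x : ℂ) * exp (2 * w * x - (x : ℂ) ^ 2)))
    (Metric.ball_mem_nhds z one_pos) (Filter.Eventually.of_forall fun w => ?_)
    ((Lp.memLp f).integrable_mul (memLp_cexp_mul_sub_sq (2 * z))) ?_
    (Filter.Eventually.of_forall fun x w hw => ?_)
    ((Lp.memLp f).norm.integrable_mul hbound)
    (Filter.Eventually.of_forall fun x w _ => ?_)).2.differentiableAt
  · exact hf.mul (by fun_prop)
  · exact hf.mul (by fun_prop)
  · rw [norm_mul]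
    refine mul_le_mul_of_nonneg_left (norm_two_mul_mul_cexp_le x ?_) (norm_nonneg _)
    have h := norm_le_norm_add_norm_sub' w z
    have := mem_ball_iff_norm.1 hw
    exact h.trans (by simp only [R]; linarith)
  · have h := (((hasDerivAt_id w).const_mul 2).mul_const (x : ℂ)).sub_const ((x : ℂ) ^ 2)
    convert! (h.cexp.const_mul (f x)) using 1
    simp only [id, mul_one]
    ring

theorem differentiable_bargmannIntegral (f : Lp ℂ 2 (volume : Measure ℝ)) :
    Differentiable ℂ (bargmannIntegral f) := by
  have h : bargmannIntegral f = fun z => (((2 / Real.pi) ^ (1 / 4 : ℝ) : ℝ) : ℂ) *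
      (exp (-(z ^ 2 / 2)) * ∫ x : ℝ, f x * exp (2 * z * x - (x : ℂ) ^ 2)) := by
    funext z
    rw [bargmannIntegral, ← integral_const_mul (exp _)]
    congr 2
    funext x
    rw [bargmannKernel_eq]
    ring
  have := differentiable_integral_mul_cexp f
  rw [h]
  fun_prop

/-! ### The isometry into the Fock space. -/

theorem eLpNorm_bargmannIntegral (f : Lp ℂ 2 (volume : Measure ℝ)) :
    eLpNorm (bargmannIntegral f) 2 gaussian = eLpNorm f 2 volume := by
  have h := lintegral_enorm_bargmannIntegral_sq f (differentiable_bargmannIntegral f).continuous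
  rw [eLpNorm_eq_lintegral_rpow_enorm_toReal (by norm_num) (by norm_num),
    eLpNorm_eq_lintegral_rpow_enorm_toReal (by norm_num) (by norm_num)]
  simpa using congrArg (fun t => t ^ (2⁻¹ : ℝ)) h

theorem bargmannIntegral_mem (f : Lp ℂ 2 (volume : Measure ℝ)) :
    bargmannIntegral f ∈ fockSubmodule :=
  ⟨differentiable_bargmannIntegral f,
    (differentiable_bargmannIntegral f).continuous.aestronglyMeasurable, by
      rw [eLpNorm_bargmannIntegral]
      exact (Lp.memLp f).2⟩

theorem bargmannIntegral_add (f g : Lp ℂ 2 (volume : Measure ℝ)) (z : ℂ) :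
    bargmannIntegral (f + g) z = bargmannIntegral f z + bargmannIntegral g z := by
  rw [bargmannIntegral, bargmannIntegral, bargmannIntegral, ← mul_add,
    ← integral_add (integrable_bargmann f z) (integrable_bargmann g z)]
  congr 1
  refine integral_congr_ae ?_
  filter_upwards [Lp.coeFn_add f g] with x hx
  rw [hx, Pi.add_apply, add_mul]

theorem bargmannIntegral_smul (c : ℂ) (f : Lp ℂ 2 (volume : Measure ℝ)) (z : ℂ) :
    bargmannIntegral (c • f) z = c * bargmannIntegral f z := by
  rw [bargmannIntegral, bargmannIntegral, mul_left_comm, ← integral_const_mul c]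
  congr 1
  refine integral_congr_ae ?_
  filter_upwards [Lp.coeFn_smul c f] with x hx
  rw [hx, Pi.smul_apply, smul_eq_mul, mul_assoc]

/-- The Bargmann transform as an isometry into the Fock space. -/
noncomputable def bargmannIsometry : Lp ℂ 2 (volume : Measure ℝ) →ₗᵢ[ℂ] Fock where
  toFun f := ⟨bargmannIntegral f, bargmannIntegral_mem f⟩
  map_add' f g := Fock.ext fun z => bargmannIntegral_add f g z
  map_smul' c f := Fock.ext fun z => bargmannIntegral_smul c f z
  norm_map' f := by
    rw [Fock.norm_def, Lp.norm_def]
    exact congrArg ENNReal.toReal (eLpNorm_bargmannIntegral f)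

/-! ### Intertwining of translations and Weyl operators. -/

theorem bargmannIntegral_translation (a : ℝ) (f : Lp ℂ 2 (volume : Measure ℝ)) (z : ℂ) :
    bargmannIntegral (translation a f) z = weylFun a (bargmannIntegral f) z := by
  have h1 : ∫ x : ℝ, translation a f x * exp (2 * (x : ℂ) * z - (x : ℂ) ^ 2 - z ^ 2 / 2) =
      ∫ x : ℝ, f (x - a) * exp (2 * ((x - a + a : ℝ) : ℂ) * z - ((x - a + a : ℝ) : ℂ) ^ 2 -
        z ^ 2 / 2) := by
    refine integral_congr_ae ?_
    filter_upwards [Lp.coeFn_compMeasurePreserving f (measurePreserving_sub_right volume a)]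
      with x hx
    rw [sub_add_cancel]
    exact congrArg (· * _) hx
  rw [weylFun, bargmannIntegral, bargmannIntegral, h1, integral_sub_right_eq_self
    (fun x : ℝ => f x * exp (2 * ((x + a : ℝ) : ℂ) * z - ((x + a : ℝ) : ℂ) ^ 2 - z ^ 2 / 2)) a,
    mul_assoc, ← integral_mul_const]
  congr 2
  funext x
  rw [mul_assoc (f x), ← Complex.exp_add]
  -- What remains is 2(x+a)z - (x+a)² - z²/2 = [2x(z-a) - x² - (z-a)²/2] + za - a²/2.
  congr 2
  have ha : ((‖(a : ℂ)‖ : ℝ) : ℂ) ^ 2 = (a : ℂ) ^ 2 := by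
    rw [norm_real, Real.norm_eq_abs]
    norm_cast
    exact sq_abs a
  rw [ha, conj_ofReal]
  push_cast
  ring

/-! ### Mean value property and point evaluation. -/

theorem integrable_exp_neg_sq_norm : Integrable fun z : ℂ => Real.exp (-‖z‖ ^ 2) := by
  have h := (GaussianFourier.integrable_cexp_neg_mul_sq_norm_add (V := ℂ) (b := 1) (by simp)
    0 0).norm
  refine h.congr (Filter.Eventually.of_forall fun z => ?_)
  simp only [Complex.norm_exp, zero_mul, add_zero, neg_mul, one_mul, neg_re]
  norm_cast

instance : IsFiniteMeasure gaussian :=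
  isFiniteMeasure_withDensity_ofReal (integrable_exp_neg_sq_norm.const_mul _).hasFiniteIntegral

theorem gaussian_ne_zero : gaussian ≠ 0 := fun h => by
  have := Fock.volume_absolutelyContinuous
  rw [h] at this
  exact NeZero.ne (volume : Measure ℂ) (Measure.absolutelyContinuous_zero_iff.1 this)

theorem integral_gaussian_eq (g : ℂ → ℂ) :
    ∫ z, g z ∂gaussian = ∫ z, (Real.pi⁻¹ * Real.exp (-‖z‖ ^ 2)) • g z := by
  rw [gaussian, integral_withDensity_eq_integral_toReal_smul (by fun_prop)
    (Filter.Eventually.of_forall fun _ => ENNReal.ofReal_lt_top)]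
  refine integral_congr_ae (Filter.Eventually.of_forall fun z => ?_)
  have : 0 ≤ Real.pi⁻¹ * Real.exp (-‖z‖ ^ 2) := by positivity
  simp only [ENNReal.toReal_ofReal this]

theorem integrableOn_polarCoord {g : ℂ → ℂ} (hg : Integrable g) (hc : Continuous g) :
    IntegrableOn (fun p : ℝ × ℝ => p.1 • g (Complex.polarCoord.symm p)) polarCoord.target := by
  have hcont : Continuous fun p : ℝ × ℝ => p.1 • g (Complex.polarCoord.symm p) := by
    simp only [Complex.polarCoord_symm_apply]
    fun_prop
  refine ⟨hcont.aestronglyMeasurable, ?_⟩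
  have h := Complex.lintegral_comp_polarCoord_symm fun z => ‖g z‖ₑ
  rw [hasFiniteIntegral_iff_enorm]
  refine lt_of_eq_of_lt ?_ (h.trans_lt hg.2)
  refine setLIntegral_congr_fun polarCoord.open_target.measurableSet fun p hp => ?_
  have hp : 0 < p.1 := hp.1
  simp only [enorm_smul, smul_eq_mul, Real.enorm_of_nonneg hp.le]

theorem integral_circle_eq {F : ℂ → ℂ} (hF : Differentiable ℂ F) (r : ℝ) :
    ∫ θ in Set.Ioo (-Real.pi) Real.pi, F (Complex.polarCoord.symm (r, θ)) =
      (2 * Real.pi) • F 0 := by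
  have hπ := Real.pi_pos
  have h := DiffContOnCl.circleAverage (f := F) (c := 0) (R := r) hF.diffContOnCl
  rw [← h, Real.circleAverage_def, smul_smul, mul_inv_cancel₀ (by positivity), one_smul,
    ← integral_Ioc_eq_integral_Ioo, ← intervalIntegral.integral_of_le (by linarith)]
  have hp : Function.Periodic (fun θ => F (circleMap 0 r θ)) (2 * Real.pi) :=
    (periodic_circleMap 0 r).comp F
  have h2 := hp.intervalIntegral_add_eq (-Real.pi) 0
  rw [zero_add, show -Real.pi + 2 * Real.pi = Real.pi by ring] at h2
  rw [← h2]
  refine intervalIntegral.integral_congr fun θ _ => ?_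
  simp only [Complex.polarCoord_symm_apply, circleMap, zero_add, Complex.exp_mul_I, ofReal_cos,
    ofReal_sin]

/-- The weight is radial, so the mean value property on each circle replaces F by F(0). The radial
integral can stay unevaluated. -/
theorem integral_gaussian_polar {F : ℂ → ℂ} (hF : Differentiable ℂ F) (hi : Integrable F gaussian) :
    ∫ z, F z ∂gaussian =
      ∫ r in Set.Ioi (0 : ℝ), (r * (Real.pi⁻¹ * Real.exp (-|r| ^ 2))) • ((2 * Real.pi) • F 0) := by
  have hi' : Integrable fun z => (Real.pi⁻¹ * Real.exp (-‖z‖ ^ 2)) • F z := by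
    rw [gaussian, integrable_withDensity_iff_integrable_smul' (by fun_prop)
      (Filter.Eventually.of_forall fun _ => ENNReal.ofReal_lt_top)] at hi
    refine hi.congr (Filter.Eventually.of_forall fun z => ?_)
    have : 0 ≤ Real.pi⁻¹ * Real.exp (-‖z‖ ^ 2) := by positivity
    simp only [ENNReal.toReal_ofReal this]
  have hp := integrableOn_polarCoord hi' (by have := hF.continuous; fun_prop)
  rw [integral_gaussian_eq, ← Complex.integral_comp_polarCoord_symm]
  rw [polarCoord_target] at hp ⊢
  rw [Measure.volume_eq_prod] at hp ⊢
  rw [setIntegral_prod _ hp]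
  refine setIntegral_congr_fun measurableSet_Ioi fun r _ => ?_
  simp only [norm_polarCoord_symm, smul_smul]
  rw [integral_smul, integral_circle_eq hF, smul_smul]

/-- The mean value property for the Gaussian measure. -/
theorem integral_gaussian_eq_mul {F : ℂ → ℂ} (hF : Differentiable ℂ F)
    (hi : Integrable F gaussian) : ∫ z, F z ∂gaussian = gaussian.real Set.univ * F 0 := by
  have h1 := integral_gaussian_polar hF hi
  -- Taking F = 1 identifies the radial constant with the total mass.
  have h2 := integral_gaussian_polar (F := fun _ => 1) (differentiable_const 1)
    (integrable_const 1)
  rw [integral_const] at h2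
  rw [h1, integral_smul_const]
  rw [integral_smul_const] at h2
  simp only [Complex.real_smul, mul_one] at h2 ⊢
  rw [h2]
  ring

/-- The constant function `1` in the Fock space. -/
noncomputable def fockOne : Fock := ⟨fun _ => 1, differentiable_const 1, memLp_const 1⟩

theorem inner_fockOne (F : Fock) : inner ℂ fockOne F = gaussian.real Set.univ * F 0 := by
  have h : inner ℂ fockOne F = inner ℂ (Fock.toLp fockOne) (Fock.toLp F) := rfl
  rw [h, L2.inner_def, ← integral_gaussian_eq_mul F.differentiable
    (F.memLp.integrable (by norm_num))]
  refine integral_congr_ae ?_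
  filter_upwards [fockOne.memLp.coeFn_toLp, F.memLp.coeFn_toLp] with z h1 h2
  have h1' : Fock.toLp fockOne z = 1 := h1
  have h2' : Fock.toLp F z = F z := h2
  simp [h1', h2']

/-- The reproducing property, up to normalization: a function in the Fock space orthogonal to
`W_w 1` vanishes at `w`. -/
theorem apply_eq_zero_of_inner_weyl_fockOne {w : ℂ} {F : Fock}
    (h : inner ℂ (weyl w fockOne) F = 0) : F w = 0 := by
  -- Unitarity gives ⟨W_w 1, F⟩ = ⟨1, W_{-w} F⟩, a nonzero multiple of (W_{-w} F)(0), hence of F(w).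
  rw [← (weyl w).symm.inner_map_map, LinearIsometryEquiv.symm_apply_apply, inner_fockOne] at h
  have hg : (gaussian.real Set.univ : ℂ) ≠ 0 := by
    rw [Ne, ofReal_eq_zero, measureReal_eq_zero_iff, Measure.measure_univ_eq_zero]
    exact gaussian_ne_zero
  have h' : weylFun (-w) F 0 = 0 := (mul_eq_zero.1 h).resolve_left hg
  rw [weylFun, mul_eq_zero] at h'
  simpa using h'.resolve_right (Complex.exp_ne_zero _)

/-! ### Surjectivity. -/

theorem bargmannIntegral_gaussian (s z : ℂ) :
    bargmannIntegral ((memLp_cexp_mul_sub_sq (2 * s)).toLp _) z =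
      (((2 / Real.pi) ^ (1 / 4 : ℝ) : ℝ) : ℂ) *
        ((Real.pi / 2) ^ (1 / 2 : ℂ) * exp (s ^ 2 / 2 + s * z)) := by
  have h1 : ∫ x : ℝ, (memLp_cexp_mul_sub_sq (2 * s)).toLp _ x *
      exp (2 * (x : ℂ) * z - (x : ℂ) ^ 2 - z ^ 2 / 2) =
      ∫ x : ℝ, exp (-2 * (x : ℂ) ^ 2 + 2 * (s + z) * x + -(z ^ 2 / 2)) := by
    refine integral_congr_ae ?_
    filter_upwards [(memLp_cexp_mul_sub_sq (2 * s)).coeFn_toLp] with x hx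
    rw [hx, ← Complex.exp_add]
    congr 1
    ring
  rw [bargmannIntegral, h1, integral_cexp_quadratic (by simp)]
  congr 3
  · norm_num
  · ring

theorem weyl_fockOne_mem_range (w : ℂ) :
    weyl w fockOne ∈ LinearMap.range bargmannIsometry.toLinearMap := by
  have hπ := Real.pi_pos
  -- B sends e^{2sx - x²} to a multiple of e^{sz}, and W_w 1 is a multiple of e^{z w̄}.
  let s := (starRingEnd ℂ) w
  let c : ℂ := (((2 / Real.pi) ^ (1 / 4 : ℝ) : ℝ) : ℂ) * (Real.pi / 2) ^ (1 / 2 : ℂ)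
  have hc : c ≠ 0 := by
    refine mul_ne_zero (ofReal_ne_zero.2 (by positivity)) ?_
    rw [Complex.cpow_ne_zero_iff_of_exponent_ne_zero (by norm_num)]
    exact div_ne_zero (ofReal_ne_zero.2 hπ.ne') two_ne_zero
  refine ⟨(c⁻¹ * exp (-(‖w‖ : ℂ) ^ 2 / 2 - s ^ 2 / 2)) •
    (memLp_cexp_mul_sub_sq (2 * s)).toLp _, ?_⟩
  rw [map_smul]
  refine Fock.ext fun z => ?_
  change c⁻¹ * exp (-(‖w‖ : ℂ) ^ 2 / 2 - s ^ 2 / 2) *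
    bargmannIntegral ((memLp_cexp_mul_sub_sq (2 * s)).toLp _) z =
      1 * exp (z * s - (‖w‖ : ℂ) ^ 2 / 2)
  rw [bargmannIntegral_gaussian, ← mul_assoc _ _ (exp (s ^ 2 / 2 + s * z)),
    show z * s - (‖w‖ : ℂ) ^ 2 / 2 =
      (-(‖w‖ : ℂ) ^ 2 / 2 - s ^ 2 / 2) + (s ^ 2 / 2 + s * z) by ring,
    Complex.exp_add _ (s ^ 2 / 2 + s * z)]
  change c⁻¹ * _ * (c * _) = _
  rw [mul_mul_mul_comm, inv_mul_cancel₀ hc]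

theorem bargmannIsometry_surjective : Function.Surjective bargmannIsometry := by
  -- Completeness comes from L²(ℝ) through the isometry, so that of the Fock space is not needed.
  have hcomplete : CompleteSpace (LinearMap.range bargmannIsometry.toLinearMap) := by
    have : IsComplete (Set.range bargmannIsometry) :=
      bargmannIsometry.isometry.isUniformInducing.isComplete_range
    exact completeSpace_coe_iff_isComplete.2 this
  have h : LinearMap.range bargmannIsometry.toLinearMap = ⊤ := by
    rw [← Submodule.orthogonal_eq_bot_iff, Submodule.eq_bot_iff]
    intro F hF
    exact Fock.ext fun w => apply_eq_zero_of_inner_weyl_fockOne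
      ((Submodule.mem_orthogonal _ F).1 hF _ (weyl_fockOne_mem_range w))
  exact LinearMap.range_eq_top.1 h

end Bargmann

/-- The Bargmann integral defines a unitary operator `B` from `L²(ℝ)` onto the Fock space `F²`, and
`B T_a B⁻¹ = W_a` for every real number `a`. -/
theorem theorem8 :
    ∃ B : MeasureTheory.Lp ℂ 2 (MeasureTheory.volume : MeasureTheory.Measure ℝ) ≃ₗᵢ[ℂ]
        Bargmann.Fock,
      (∀ (f : MeasureTheory.Lp ℂ 2 (MeasureTheory.volume : MeasureTheory.Measure ℝ)) (z : ℂ),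
        B f z = Bargmann.bargmannIntegral f z) ∧
      ∀ a : ℝ, (B.symm.trans (Bargmann.translation a)).trans B = Bargmann.weyl (a : ℂ) := by
  let B := LinearIsometryEquiv.ofSurjective Bargmann.bargmannIsometry
    Bargmann.bargmannIsometry_surjective
  refine ⟨B, fun f z => rfl, fun a => LinearIsometryEquiv.ext fun F => ?_⟩
  obtain ⟨f, rfl⟩ := B.surjective F
  rw [LinearIsometryEquiv.trans_apply, LinearIsometryEquiv.trans_apply,
    LinearIsometryEquiv.symm_apply_apply]
  exact Bargmann.Fock.ext fun z => Bargmann.bargmannIntegral_translation a f z
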